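/- Let $q$ be a prime power, $m\ge 2$, and let $r$ be a divisor of $q-1$ with $2<r<q-1$. Let $\ell=(q-1)a+b$ with integers $0\le a\le m-2$, $0\le b\le q-2$ and $b\equiv r-1\pmod r$. Let $\mathcal M(q,m,r,\ell)\subseteq\mathbb F_q[X_1,\ldots,X_m]$ be the $\mathbb F_q$-linear span of all monomials $X_1^{i_1}\cdots X_m^{i_m}$ with $0\le i_j\le q-1$ for every $j$, $i_1+\cdots+i_m\le \ell$, and $i_1+\cdots+i_m\equiv r-1\pmod r$. For a polynomial $f$ let $\operatorname{Supp}(f)=\{P\in\mathbb F_q^m: f(P)\ne 0\}$ be its affine support. Then every nonzero $f\in\mathcal M(q,m,r,\ell)$ satisfies $$|\operatorname{Supp}(f)|\ne (q-b)\,q^{m-a-1},$$ that is, no nonzero $f\in\mathcal M(q,m,r,\ell)$ has affine support of size $(q-b)q^{m-a-1}$. -/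

import Mathlib

/-- The span over `F` of the reduced monomials `X₁^{i₁} ⋯ X_m^{i_m}` with `0 ≤ i_j ≤ q - 1`,
`i₁ + ⋯ + i_m ≤ ℓ` and `i₁ + ⋯ + i_m ≡ r - 1 (mod r)`. Its elements are reduced polynomials,
so for `q = |F|` they are the unique reduced representatives of the functions they define. -/
noncomputable def residueMonomialSpace (F : Type*) [Field F] (q m r ℓ : ℕ) :
    Submodule F (MvPolynomial (Fin m) F) :=
  Submodule.span F
    {p | ∃ i : Fin m →₀ ℕ, (∀ j, i j ≤ q - 1) ∧ ∑ j, i j ≤ ℓ ∧ ∑ j, i j ≡ r - 1 [MOD r] ∧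
      p = MvPolynomial.monomial i 1}

/-- The set of points of the affine space `F^m` at which the polynomial `f` does not vanish. -/
def affineSupport {F : Type*} [Field F] {m : ℕ} (f : MvPolynomial (Fin m) F) :
    Set (Fin m → F) :=
  {P | MvPolynomial.eval P f ≠ 0}

/-!
The proof rests on a congruence for the size of the support. Every monomial occurring in `f` has
total degree congruent to `r - 1` modulo `r`, so for an `r`-th root of unity `ζ` one has
`f (ζ P) = ζ ^ (r - 1) * f P` (`eval_smul_of_mem_residueMonomialSpace`), and `f` vanishes at the
origin because `r - 1 > 0`. The support is therefore a union of orbits of the group of `r`-th roots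
of unity acting on the nonzero vectors. This action is free, and the group has order `r` since
`r ∣ q - 1`, so `r` divides the size of the support (`dvd_ncard_affineSupport`).

On the other hand `q ≡ 1` and `b ≡ -1` modulo `r`, so `(q - b) * q ^ (m - a - 1) ≡ 2` modulo `r`,
which is not divisible by `r > 2`.
-/

theorem eval_smul_of_mem_residueMonomialSpace {F : Type*} [Field F] {q m r ℓ : ℕ}
    {f : MvPolynomial (Fin m) F} (hf : f ∈ residueMonomialSpace F q m r ℓ)
    {ζ : F} (hζ : ζ ^ r = 1) (P : Fin m → F) :
    MvPolynomial.eval (ζ • P) f = ζ ^ (r - 1) * MvPolynomial.eval P f := by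
  induction hf using Submodule.span_induction with
  | mem p hp =>
    obtain ⟨i, -, -, hi, rfl⟩ := hp
    have hpow : ζ ^ (∑ j, i j) = ζ ^ (r - 1) := by
      rw [← Nat.mod_add_div (∑ j, i j) r, ← Nat.mod_add_div (r - 1) r, show (∑ j, i j) % r = _ from hi]
      simp only [pow_add, pow_mul, hζ, one_pow]
    rw [MvPolynomial.eval_monomial, MvPolynomial.eval_monomial,
      Finsupp.prod_fintype _ _ fun _ ↦ pow_zero _, Finsupp.prod_fintype _ _ fun _ ↦ pow_zero _]
    simp only [one_mul, Pi.smul_apply, smul_eq_mul, mul_pow, Finset.prod_mul_distrib,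
      Finset.prod_pow_eq_pow_sum, hpow]
  | zero => simp
  | add x y _ _ hx hy => simp only [map_add, hx, hy, mul_add]
  | smul c x _ hx => simp only [MvPolynomial.smul_eval, hx]; ring

theorem zero_notMem_affineSupport {F : Type*} [Field F] {q m r ℓ : ℕ} (hr : 1 < r)
    {f : MvPolynomial (Fin m) F} (hf : f ∈ residueMonomialSpace F q m r ℓ) :
    (0 : Fin m → F) ∉ affineSupport f := by
  have hmod : (r - 1) % r ≠ 0 := by rw [Nat.mod_eq_of_lt (by omega)]; omega
  simp only [affineSupport, Set.mem_ofPred_eq, not_not]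
  induction hf using Submodule.span_induction with
  | mem p hp =>
    obtain ⟨i, -, -, hi, rfl⟩ := hp
    have hsum : ∑ j, i j ≠ 0 := by
      intro h
      rw [h] at hi
      exact hmod ((Eq.symm hi).trans (Nat.zero_mod r))
    rw [MvPolynomial.eval_monomial, Finsupp.prod_fintype _ _ fun _ ↦ pow_zero _]
    simp only [one_mul, Pi.zero_apply, Finset.prod_pow_eq_pow_sum, zero_pow hsum]
  | zero => simp
  | add x y _ _ hx hy => simp only [map_add, hx, hy, add_zero]
  | smul c x _ hx => simp only [MvPolynomial.smul_eval, hx, mul_zero]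

theorem natCard_rootsOfUnity_of_dvd {F : Type*} [Field F] [Finite F] {r : ℕ}
    (h : r ∣ Nat.card F - 1) : Nat.card (rootsOfUnity r F) = r := by
  have hcard : Nat.card Fˣ = Nat.card F - 1 := Nat.card_units F
  obtain ⟨k, hk⟩ := h
  obtain ⟨g, hg⟩ := IsCyclic.exists_ofOrder_eq_natCard (α := Fˣ)
  have hpos : 0 < Nat.card Fˣ := Nat.card_pos
  have hprim : IsPrimitiveRoot (g ^ k) r :=
    (IsPrimitiveRoot.orderOf g).pow (hg ▸ hpos) (by rw [hg, hcard, hk, mul_comm])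
  have : NeZero r := ⟨by rintro rfl; omega⟩
  exact (IsPrimitiveRoot.coe_units_iff.mpr hprim).card_rootsOfUnity

/-- The roots of unity of order dividing `r` act freely on the support by scaling. -/
theorem dvd_ncard_affineSupport {F : Type*} [Field F] [Finite F] {q m r ℓ : ℕ}
    (hr : 1 < r) (hrF : r ∣ Nat.card F - 1)
    {f : MvPolynomial (Fin m) F} (hf : f ∈ residueMonomialSpace F q m r ℓ) :
    r ∣ (affineSupport f).ncard := by
  let S : SubMulAction (rootsOfUnity r F) (Fin m → F) :=
    { carrier := affineSupport f
      smul_mem' := fun u P hP ↦ by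
        have hu : ((u : Fˣ) : F) ^ r = 1 := (mem_rootsOfUnity' r (u : Fˣ)).mp u.2
        change MvPolynomial.eval (((u : Fˣ) : F) • P) f ≠ 0
        rw [eval_smul_of_mem_residueMonomialSpace hf hu]
        exact mul_ne_zero (pow_ne_zero _ (Units.ne_zero _)) hP }
  have hfree : ∀ P : S, MulAction.stabilizer (rootsOfUnity r F) P = ⊥ := by
    refine fun P ↦ (Subgroup.eq_bot_iff_forall _).mpr fun u hu ↦ ?_
    have hP : (P : Fin m → F) ≠ 0 := fun h ↦ zero_notMem_affineSupport hr hf (h ▸ P.2)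
    have hfix : ((u : Fˣ) : F) • (P : Fin m → F) = P :=
      congrArg Subtype.val (MulAction.mem_stabilizer_iff.mp hu)
    have hone : ((u : Fˣ) : F) = 1 := smul_left_injective F hP (by simpa using hfix)
    exact Subtype.ext (Units.ext hone)
  have hcard := Nat.card_congr (MulAction.selfEquivOrbitsQuotientProd hfree)
  rw [Nat.card_prod, natCard_rootsOfUnity_of_dvd hrF] at hcard
  change r ∣ Nat.card S
  exact hcard ▸ Dvd.intro_left _ rfl

theorem mainTheorem3 {F : Type*} [Field F] [Finite F] (q m r ℓ a b : ℕ)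
    (hq : Nat.card F = q) (hm : 2 ≤ m) (hrq : r ∣ q - 1) (hr : 2 < r) (hr' : r < q - 1)
    (hℓ : ℓ = (q - 1) * a + b) (ha : a ≤ m - 2) (hb : b ≤ q - 2) (hbr : b ≡ r - 1 [MOD r])
    (f : MvPolynomial (Fin m) F) (hf : f ∈ residueMonomialSpace F q m r ℓ) (hf0 : f ≠ 0) :
    (affineSupport f).ncard ≠ (q - b) * q ^ (m - a - 1) := by
  intro h
  have hdvd : r ∣ (q - b) * q ^ (m - a - 1) :=
    h ▸ dvd_ncard_affineSupport (by omega) (hq ▸ hrq) hf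
  have hq1 : q ≡ 1 [MOD r] := ((Nat.modEq_iff_dvd' (by omega)).mpr hrq).symm
  have hqb : q - b ≡ 2 [MOD r] := by
    have hb1 : b + 1 ≡ 0 [MOD r] := by
      simpa [Nat.sub_add_cancel (show 1 ≤ r by omega), Nat.ModEq] using hbr.add_right 1
    have hsum : (q - b) + (b + 1) ≡ 2 + 0 [MOD r] := by
      rw [show (q - b) + (b + 1) = q + 1 by omega]
      exact hq1.add_right 1
    exact hb1.add_right_cancel hsum
  have htwo : (q - b) * q ^ (m - a - 1) ≡ 2 [MOD r] := by
    simpa using hqb.mul (hq1.pow (m - a - 1))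
  have : r ∣ 2 := (htwo.dvd_iff dvd_rfl).mp hdvd
  exact absurd (Nat.le_of_dvd two_pos this) (by omega)
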